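/- Let $d\ge 1$ be an integer and let $A=M_d(\mathbb C)$ be the $C^*$-algebra of complex $d\times d$ matrices, with unit $I$; for $a\in A$ let $|a|$ denote the unique positive square root of $a^*a$. Let $H$ be a (left) Hilbert $A$-module, that is, a left $A$-module with a map $[\cdot,\cdot]:H\times H\to A$ such that, for all $f,g,h\in H$ and $a\in A$, $[f+g,h]=[f,h]+[g,h]$, $[af,g]=a[f,g]$, $[g,f]=[f,g]^*$, $[f,f]\ge 0$, and $[f,f]=0$ if and only if $f=0$, and which is complete in the norm $f\mapsto \|[f,f]\|^{1/2}$. Suppose that there exist $g,h\in H$ with $[g,h]=I$. Let $T:H\to H$ be a surjective function (not assumed to be linear) such that $$|[Tf,Tf']|=|[f,f']|\qquad (f,f'\in H).$$ If $d>1$, then there exist a function $\varphi:H\to\mathbb C$ with $|\varphi(f)|=1$ for all $f\in H$ and an $A$-unitary operator $U:H\to H$ (that is, a linear bijection with $U(af)=aUf$ and $[Uf,Uf']=[f,f']$ for all $f,f'\in H$, $a\in A$) such that $Tf=\varphi(f)\,Uf$ for all $f\in H$. If $d=1$, then there exist a function $\varphi:H\to\mathbb C$ with $|\varphi(f)|=1$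 for all $f\in H$ and an operator $U:H\to H$ that is either unitary (a linear bijection with $[Uf,Uf']=[f,f']$ for all $f,f'\in H$) or antiunitary (a conjugate-linear bijection with $[Uf,Uf']=[f',f]$ for all $f,f'\in H$) such that $Tf=\varphi(f)\,Uf$ for all $f\in H$. -/

import Mathlib

open scoped ComplexOrder MatrixOrder Matrix.Norms.L2Operator

/-- The `C⋆`-algebra `M_d(ℂ)` of complex `d × d` matrices; the star is the conjugate transpose, the
order is the Loewner order and the norm is the operator norm on Euclidean space. -/
abbrev MatAlg (d : ℕ) : Type := Matrix (Fin d) (Fin d) ℂ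

/-- The generalized inner product `[f, g]` of a Hilbert module over `M_d(ℂ)`, with the convention
`[a f, g] = a [f, g]`. Mathlib's inner product satisfies `inner x (a • y) = a * inner x y`, so the
arguments are exchanged. -/
def genInner (d : ℕ) {H : Type*} [NormedAddCommGroup H] [Module ℂ H]
    [Module (MatAlg d) H] [CStarModule (MatAlg d) H] (f g : H) : MatAlg d :=
  inner (MatAlg d) g f

/-- A linear bijection `U` is `A`-unitary, `A = M_d(ℂ)`, if it commutes with the action of `A` and
preserves the generalized inner product. -/
structure IsModuleUnitary (d : ℕ) {H : Type*} [NormedAddCommGroup H] [Module ℂ H]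
    [Module (MatAlg d) H] [CStarModule (MatAlg d) H] (U : H ≃ₗ[ℂ] H) : Prop where
  map_smul : ∀ (a : MatAlg d) (f : H), U (a • f) = a • U f
  map_inner : ∀ f f' : H, genInner d (U f) (U f') = genInner d f f'

/-- A linear bijection is unitary if it preserves the inner product. -/
def IsUnitaryOp (d : ℕ) {H : Type*} [NormedAddCommGroup H] [Module ℂ H]
    [Module (MatAlg d) H] [CStarModule (MatAlg d) H] (U : H ≃ₗ[ℂ] H) : Prop :=
  ∀ f f' : H, genInner d (U f) (U f') = genInner d f f'

/-- A conjugate-linear bijection is antiunitary if it exchanges the arguments of the inner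
product. -/
def IsAntiunitaryOp (d : ℕ) {H : Type*} [NormedAddCommGroup H] [Module ℂ H]
    [Module (MatAlg d) H] [CStarModule (MatAlg d) H] (U : H ≃ₛₗ[starRingEnd ℂ] H) : Prop :=
  ∀ f f' : H, genInner d (U f) (U f') = genInner d f' f

/-- A phase function: its values have modulus one. -/
def IsPhaseFunction {H : Type*} (φ : H → ℂ) : Prop := ∀ f : H, ‖φ f‖ = 1

/-! Cutting down by the rank-one projection `E_oo` turns `H` into `d`-tuples ("rows") of vectors in
the complex inner product space `corner H o`, and `[f, g]` becomes the matrix of inner products of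
rows (`genInner_apply`). Since `T` preserves `[f, f]`, it maps the corner onto itself and preserves
moduli of inner products there, so `wigner` yields a linear or conjugate-linear isometry `V`.

For `x` in the corner, `|[x, f]|^2` records the products `⟪x, f_i⟫ ⟪f_j, x⟫`, which by polarization
determine all rank-one operators built from pairs of rows. If `V` is linear, `T f` and `V` applied
row by row give the same operators, hence differ by one phase (`exists_phase_smul_of_rows`). If `V`
is conjugate-linear, the operators get transposed, which is impossible for two independent rows;
`[g, h] = I` supplies these when `d > 1` (`false_of_conj_linear`). For `d = 1` the corner is all of
`H`. -/

open scoped InnerProductSpace ComplexConjugate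

/-! ### Wigner's theorem in complex inner product spaces -/

section Wigner

variable {K S : Type*} [NormedAddCommGroup K] [InnerProductSpace ℂ K]
  [NormedAddCommGroup S] [InnerProductSpace ℂ S]

/-- The equality case of Cauchy–Schwarz. -/
theorem exists_phase_of_norm_inner_eq {a b : K} (hab : ‖a‖ = ‖b‖)
    (h : ‖⟪b, a⟫_ℂ‖ = ‖b‖ ^ 2) : ∃ c : ℂ, ‖c‖ = 1 ∧ a = c • b := by
  rcases eq_or_ne b 0 with rfl | hb
  · exact ⟨1, by simp, by simpa using hab⟩
  have ha : a ≠ 0 := by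
    rintro rfl
    exact hb (by simpa using hab.symm)
  obtain ⟨r, -, hr⟩ := (norm_inner_eq_norm_iff hb ha).1 (by rw [h, hab, sq])
  refine ⟨r, ?_, hr⟩
  have hb' : ‖b‖ ≠ 0 := norm_ne_zero_iff.2 hb
  rw [hr, norm_smul] at hab
  exact mul_right_cancel₀ hb' (by rw [hab, one_mul])

theorem norm_map_of_norm_inner_map_map {τ : S → K}
    (hτ : ∀ x y, ‖⟪τ x, τ y⟫_ℂ‖ = ‖⟪x, y⟫_ℂ‖) (x : S) : ‖τ x‖ = ‖x‖ := by
  have := hτ x x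
  rwa [inner_self_eq_norm_sq_to_K, inner_self_eq_norm_sq_to_K, norm_pow, norm_pow,
    RCLike.norm_ofReal, RCLike.norm_ofReal, abs_norm, abs_norm,
    sq_eq_sq₀ (norm_nonneg _) (norm_nonneg _)] at this

theorem inner_map_map_of_conj_isometry (W : S →ₛₗᵢ[starRingEnd ℂ] K) (x y : S) :
    ⟪W x, W y⟫_ℂ = ⟪y, x⟫_ℂ := by
  have h1 : ‖W x - Complex.I • W y‖ = ‖x + Complex.I • y‖ := by
    rw [← W.norm_map (x + Complex.I • y)]
    simp [map_smulₛₗ, sub_eq_add_neg]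
  have h2 : ‖W x + Complex.I • W y‖ = ‖x - Complex.I • y‖ := by
    rw [← W.norm_map (x - Complex.I • y)]
    simp [map_smulₛₗ, sub_eq_add_neg]
  rw [← inner_conj_symm y x, inner_eq_sum_norm_sq_div_four (W x), inner_eq_sum_norm_sq_div_four x]
  have h4 : conj (4 : ℂ) = 4 := map_ofNat _ 4
  simp only [Complex.coe_algebraMap, RCLike.I_to_complex, h1, h2, ← map_add, ← map_sub, W.norm_map,
    map_div₀, h4]
  simp
  ring

/-- Preserved real parts make `V` real-linear. Preserved moduli force `V (i x) = ± i V x`, and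
additivity makes the sign independent of `x`. -/
theorem linear_or_conj_linear_isometry (V : S → K)
    (hre : ∀ x y, (⟪V x, V y⟫_ℂ).re = (⟪x, y⟫_ℂ).re)
    (habs : ∀ x y, ‖⟪V x, V y⟫_ℂ‖ = ‖⟪x, y⟫_ℂ‖) :
    (∃ W : S →ₗᵢ[ℂ] K, ∀ x, V x = W x) ∨
      ∃ W : S →ₛₗᵢ[starRingEnd ℂ] K, ∀ x, V x = W x := by
  have hnorm := norm_map_of_norm_inner_map_map habs
  have hadd : ∀ x y, V (x + y) = V x + V y := fun x y => by
    rw [← sub_eq_zero, ← norm_eq_zero, ← sq_eq_zero_iff, norm_sq_eq_re_inner (𝕜 := ℂ)]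
    simp only [RCLike.re_to_complex, inner_sub_left, inner_sub_right, inner_add_left,
      inner_add_right, Complex.sub_re, Complex.add_re, hre]
    ring
  have hsmul : ∀ (r : ℝ) x, V ((r : ℂ) • x) = (r : ℂ) • V x := fun r x => by
    rw [← sub_eq_zero, ← norm_eq_zero, ← sq_eq_zero_iff, norm_sq_eq_re_inner (𝕜 := ℂ)]
    simp only [RCLike.re_to_complex, inner_sub_left, inner_sub_right, inner_smul_left,
      inner_smul_right, Complex.sub_re, Complex.conj_ofReal, Complex.re_ofReal_mul, hre]
    ring
  have hI : ∀ x, V (Complex.I • x) = Complex.I • V x ∨ V (Complex.I • x) = -(Complex.I • V x) := by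
    intro x
    obtain ⟨c, hc, hcx⟩ := exists_phase_of_norm_inner_eq (a := V (Complex.I • x)) (b := V x)
      (by rw [hnorm, hnorm, norm_smul]; simp)
      (by rw [habs, hnorm, inner_smul_right, norm_mul]; simp)
    rcases eq_or_ne x 0 with rfl | hx
    · left
      have : V 0 = 0 := by rw [← norm_eq_zero, hnorm, norm_zero]
      simp [this]
    have h0 : c.re = 0 := by
      have h := hre x (Complex.I • x)
      rw [hcx, inner_smul_right, inner_smul_right, inner_self_eq_norm_sq_to_K,
        inner_self_eq_norm_sq_to_K, hnorm] at h
      have hx' : ‖x‖ ≠ 0 := norm_ne_zero_iff.2 hx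
      simpa [← Complex.ofReal_pow, hx'] using h
    have h1 : c.im = 1 ∨ c.im = -1 := by
      have h := Complex.sq_norm c
      rw [hc, Complex.normSq_apply, h0] at h
      rw [← sq_eq_one_iff]
      nlinarith
    rcases h1 with h1 | h1
    · left
      rw [hcx, show c = Complex.I from Complex.ext (by simp [h0]) (by simp [h1])]
    · right
      rw [hcx, ← neg_smul, show c = -Complex.I from Complex.ext (by simp [h0]) (by simp [h1])]
  have hdec : ∀ (c : ℂ) x, V (c • x) = (c.re : ℂ) • V x + (c.im : ℂ) • V (Complex.I • x) := by
    intro c x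
    rw [← hsmul, ← hsmul, ← hadd, smul_smul, ← add_smul, Complex.re_add_im]
  by_cases hlin : ∀ x, V (Complex.I • x) = Complex.I • V x
  · refine .inl ⟨⟨⟨⟨V, hadd⟩, fun c x => ?_⟩, hnorm⟩, fun _ => rfl⟩
    change V (c • x) = c • V x
    rw [hdec, hlin, smul_smul, ← add_smul, Complex.re_add_im]
  · push Not at hlin
    obtain ⟨z, hz⟩ := hlin
    have hz' := (hI z).resolve_left hz
    have hconj : ∀ x, V (Complex.I • x) = -(Complex.I • V x) := by
      intro w
      by_contra hw
      have hw' := (hI w).resolve_right hw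
      -- Both signs occur, at `z` and at `w`; either sign at `z + w` contradicts one of them.
      have key := hI (z + w)
      rw [smul_add, hadd, hadd, hz', hw', smul_add] at key
      rcases key with h | h
      · apply hz
        rw [hz']
        exact add_right_cancel h
      · apply hw
        rw [hw']
        rw [neg_add] at h
        exact add_left_cancel h
    refine .inr ⟨⟨⟨⟨V, hadd⟩, fun c x => ?_⟩, hnorm⟩, fun _ => rfl⟩
    change V (c • x) = conj c • V x
    rw [hdec, hconj, ← neg_smul, smul_smul, ← add_smul]
    congr 1
    apply Complex.ext <;> simp

/-- The orthogonal projection along a unit vector. -/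
noncomputable def projAlong (e : K) (he : ‖e‖ = 1) : K →ₗ[ℂ] (ℂ ∙ e)ᗮ :=
  LinearMap.codRestrict _ (LinearMap.id - (innerₛₗ ℂ e).smulRight e) fun x => by
    rw [Submodule.mem_orthogonal_singleton_iff_inner_right]
    simp [inner_sub_right, inner_smul_right, inner_self_eq_norm_sq_to_K, he]

theorem projAlong_coe (e : K) (he : ‖e‖ = 1) (x : K) :
    (projAlong e he x : K) = x - ⟪e, x⟫_ℂ • e := rfl

theorem norm_add_sq_of_inner_eq_zero {x y : K} (h : ⟪x, y⟫_ℂ = 0) :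
    ‖x + y‖ ^ 2 = ‖x‖ ^ 2 + ‖y‖ ^ 2 := by
  rw [sq, sq, sq, norm_add_sq_eq_norm_sq_add_norm_sq_of_inner_eq_zero x y h]

theorem inner_coe_orthogonal_singleton (e : K) (z : (ℂ ∙ e)ᗮ) : ⟪e, (z : K)⟫_ℂ = 0 :=
  Submodule.mem_orthogonal_singleton_iff_inner_right.1 z.2

theorem exists_isometry_extending {σ : ℂ →+* ℂ} (hσ : ∀ c, ‖σ c‖ = ‖c‖) {e e' : K}
    (he : ‖e‖ = 1) (he' : ‖e'‖ = 1) (W : (ℂ ∙ e)ᗮ →ₛₗᵢ[σ] K) (hW : ∀ z, ⟪e', W z⟫_ℂ = 0) :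
    ∃ U : K →ₛₗᵢ[σ] K, ∀ (c : ℂ) (z : (ℂ ∙ e)ᗮ), U (c • e + z) = σ c • e' + W z := by
  have hin : ∀ (c : ℂ) (z : (ℂ ∙ e)ᗮ), ⟪e, c • e + (z : K)⟫_ℂ = c := fun c z => by
    simp [inner_self_eq_norm_sq_to_K, he, inner_coe_orthogonal_singleton]
  have hproj : ∀ (c : ℂ) (z : (ℂ ∙ e)ᗮ), projAlong e he (c • e + z) = z := fun c z =>
    Subtype.ext (by
      rw [projAlong_coe, hin]
      exact add_sub_cancel_left _ _)
  refine ⟨⟨⟨⟨fun x => σ ⟪e, x⟫_ℂ • e' + W (projAlong e he x), fun x y => ?_⟩, fun c x => ?_⟩,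
    fun x => ?_⟩, fun c z => ?_⟩
  · simp only [inner_add_right, map_add, add_smul]
    abel
  · simp only [inner_smul_right, map_mul, map_smul, map_smulₛₗ, smul_add, smul_smul]
  · change ‖σ ⟪e, x⟫_ℂ • e' + W (projAlong e he x)‖ = ‖x‖
    rw [← sq_eq_sq₀ (norm_nonneg _) (norm_nonneg _),
      norm_add_sq_of_inner_eq_zero (by rw [inner_smul_left, hW, mul_zero]), W.norm_map, norm_smul,
      hσ, he']
    have hx : x = ⟪e, x⟫_ℂ • e + (projAlong e he x : K) := by simp [projAlong_coe]
    conv_rhs => rw [hx, norm_add_sq_of_inner_eq_zero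
      (by rw [inner_smul_left, inner_coe_orthogonal_singleton, mul_zero]), norm_smul, he]
    rfl
  · change σ ⟪e, c • e + (z : K)⟫_ℂ • e' + W (projAlong e he (c • e + z)) = _
    rw [hin, hproj]

/-- Up to phase `τ` is homogeneous, so it is determined by its values on the affine slice `e + eᗮ`
and on `eᗮ`. -/
theorem exists_phase_comp_eq {σ : ℂ →+* ℂ} (hσ : ∀ c, ‖σ c‖ = ‖c‖) {e : K} (he : ‖e‖ = 1)
    (τ : K → K) (hτ : ∀ x y, ‖⟪τ x, τ y⟫_ℂ‖ = ‖⟪x, y⟫_ℂ‖) (W : (ℂ ∙ e)ᗮ →ₛₗᵢ[σ] K)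
    (hW : ∀ z, ⟪τ e, W z⟫_ℂ = 0)
    (hadd : ∀ z : (ℂ ∙ e)ᗮ, ∃ c : ℂ, ‖c‖ = 1 ∧ τ (e + z) = c • (τ e + W z))
    (hz : ∀ z : (ℂ ∙ e)ᗮ, ∃ c : ℂ, ‖c‖ = 1 ∧ τ z = c • W z) :
    ∃ U : K →ₛₗᵢ[σ] K, ∀ x, ∃ c : ℂ, ‖c‖ = 1 ∧ τ x = c • U x := by
  have hnorm := norm_map_of_norm_inner_map_map hτ
  obtain ⟨U, hU⟩ := exists_isometry_extending hσ he ((hnorm e).trans he) W hW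
  refine ⟨U, fun x => ?_⟩
  have hx : x = ⟪e, x⟫_ℂ • e + (projAlong e he x : K) := by simp [projAlong_coe]
  generalize ⟪e, x⟫_ℂ = a at hx
  generalize projAlong e he x = z at hx
  rcases eq_or_ne a 0 with rfl | ha
  · rw [hx, hU]
    simpa using hz z
  · obtain ⟨c, hc, hcz⟩ := hadd (a⁻¹ • z)
    have hxa : x = a • (e + ((a⁻¹ • z : (ℂ ∙ e)ᗮ) : K)) := by
      rw [smul_add, Submodule.coe_smul, smul_inv_smul₀ ha, hx]
    obtain ⟨b, hb, hbx⟩ := exists_phase_of_norm_inner_eq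
      (a := τ x) (b := a • τ (e + ((a⁻¹ • z : (ℂ ∙ e)ᗮ) : K)))
      (by rw [hnorm, norm_smul, hnorm, ← norm_smul, ← hxa])
      (by
        rw [inner_smul_left, norm_mul, hτ, norm_smul, hnorm, mul_pow, RCLike.norm_conj]
        conv_lhs => rw [hxa]
        rw [inner_smul_right, norm_mul, inner_self_eq_norm_sq_to_K, norm_pow, RCLike.norm_ofReal,
          abs_norm]
        ring)
    have hσa : σ a ≠ 0 := (map_ne_zero σ).2 ha
    -- `b` comes from rescaling by `a`, `c` from the slice, and `a / σ a` from the semilinearity of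
    -- `U`.
    refine ⟨b * c * (a / σ a), ?_, ?_⟩
    · rw [norm_mul, norm_mul, norm_div, hσ, hb, hc, div_self (norm_ne_zero_iff.2 ha)]
      norm_num
    · rw [hbx, hcz, hx, hU, map_smulₛₗ, map_inv₀, smul_smul, smul_smul, smul_add, smul_add,
        smul_smul, smul_smul]
      congr 2 <;> field_simp

/-- **Wigner's theorem**, without surjectivity. -/
theorem wigner (τ : K → K) (hτ : ∀ x y, ‖⟪τ x, τ y⟫_ℂ‖ = ‖⟪x, y⟫_ℂ‖) :
    (∃ U : K →ₗᵢ[ℂ] K, ∀ x, ∃ c : ℂ, ‖c‖ = 1 ∧ τ x = c • U x) ∨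
      ∃ U : K →ₛₗᵢ[starRingEnd ℂ] K, ∀ x, ∃ c : ℂ, ‖c‖ = 1 ∧ τ x = c • U x := by
  have hnorm := norm_map_of_norm_inner_map_map hτ
  rcases subsingleton_or_nontrivial K with hK | hK
  · exact .inl ⟨.id, fun x => ⟨1, by simp, Subsingleton.elim _ _⟩⟩
  obtain ⟨e, he⟩ := exists_norm_eq K zero_le_one
  -- Fix the free phase of `τ (e + z)` by making its component along `τ e` equal to `τ e`; the
  -- remainder is `w`.
  have hex : ∀ z : (ℂ ∙ e)ᗮ, ∃ w : K, ⟪τ e, w⟫_ℂ = 0 ∧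
      (∃ c : ℂ, ‖c‖ = 1 ∧ τ (e + z) = c • (τ e + w)) ∧ ∃ c : ℂ, ‖c‖ = 1 ∧ w = c • τ z := by
    intro z
    have hez := inner_coe_orthogonal_singleton e z
    have ha : ‖⟪τ e, τ (e + z)⟫_ℂ‖ = 1 := by
      rw [hτ, inner_add_right, hez, inner_self_eq_norm_sq_to_K, he]; simp
    set a := ⟪τ e, τ (e + z)⟫_ℂ with ha_def
    have ha0 : a ≠ 0 := norm_ne_zero_iff.1 (by rw [ha]; exact one_ne_zero)
    have hw : ⟪τ e, a⁻¹ • τ (e + z) - τ e⟫_ℂ = 0 := by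
      rw [inner_sub_right, inner_smul_right, ← ha_def, inner_self_eq_norm_sq_to_K, hnorm, he,
        inv_mul_cancel₀ ha0]
      simp
    have hsum : a • (τ e + (a⁻¹ • τ (e + z) - τ e)) = τ (e + z) := by
      rw [add_sub_cancel, smul_inv_smul₀ ha0]
    refine ⟨a⁻¹ • τ (e + z) - τ e, hw, ⟨a, ha, hsum.symm⟩, exists_phase_of_norm_inner_eq ?_ ?_⟩
    · rw [hnorm, ← sq_eq_sq₀ (norm_nonneg _) (norm_nonneg _)]
      have h1 := norm_add_sq_of_inner_eq_zero hw
      have h2 := norm_add_sq_of_inner_eq_zero hez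
      rw [add_sub_cancel, norm_smul, norm_inv, ha, inv_one, one_mul, hnorm, h2, hnorm] at h1
      linarith
    · have h0 : ⟪τ z, τ e⟫_ℂ = 0 := by
        rw [← norm_eq_zero, hτ, inner_eq_zero_symm.1 hez, norm_zero]
      rw [inner_sub_right, inner_smul_right, h0, sub_zero, norm_mul, norm_inv, ha, inv_one,
        one_mul, hτ, inner_add_right, inner_eq_zero_symm.1 hez, zero_add,
        inner_self_eq_norm_sq_to_K, norm_pow, RCLike.norm_ofReal, abs_norm, hnorm]
  choose V hVe hVadd hVz using hex
  have habs : ∀ x y, ‖⟪V x, V y⟫_ℂ‖ = ‖⟪x, y⟫_ℂ‖ := by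
    intro x y
    obtain ⟨c, hc, hcx⟩ := hVz x
    obtain ⟨b, hb, hby⟩ := hVz y
    rw [hcx, hby, inner_smul_left, inner_smul_right, norm_mul, norm_mul, RCLike.norm_conj, hc, hb,
      hτ]
    simp
  -- Compare `|1 + ⟪x, y⟫|²` with `|⟪x, y⟫|²`: the difference is `1 + 2 Re ⟪x, y⟫`.
  have hre : ∀ x y, (⟪V x, V y⟫_ℂ).re = (⟪x, y⟫_ℂ).re := by
    intro x y
    obtain ⟨c, hc, hcx⟩ := hVadd x
    obtain ⟨b, hb, hby⟩ := hVadd y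
    have h1 := hτ (e + x) (e + y)
    rw [hcx, hby, inner_smul_left, inner_smul_right, norm_mul, norm_mul, RCLike.norm_conj, hc, hb,
      one_mul, one_mul, inner_add_left, inner_add_left, inner_add_right, inner_add_right,
      inner_add_right, inner_add_right, hVe, inner_eq_zero_symm.1 (hVe x),
      inner_coe_orthogonal_singleton, inner_eq_zero_symm.1 (inner_coe_orthogonal_singleton e x),
      inner_self_eq_norm_sq_to_K, inner_self_eq_norm_sq_to_K, hnorm, he] at h1
    have h2 := habs x y
    rw [Submodule.coe_inner] at *
    rw [← sq_eq_sq₀ (norm_nonneg _) (norm_nonneg _), Complex.sq_norm, Complex.sq_norm,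
      Complex.normSq_apply, Complex.normSq_apply] at h1 h2
    simp at h1
    nlinarith
  have hVτ : ∀ z : (ℂ ∙ e)ᗮ, ∃ c : ℂ, ‖c‖ = 1 ∧ τ z = c • V z := by
    intro z
    obtain ⟨c, hc, hcz⟩ := hVz z
    have hc0 : c ≠ 0 := norm_ne_zero_iff.1 (by rw [hc]; exact one_ne_zero)
    exact ⟨c⁻¹, by rw [norm_inv, hc, inv_one], by rw [hcz, inv_smul_smul₀ hc0]⟩
  rcases linear_or_conj_linear_isometry V hre habs with ⟨W, hW⟩ | ⟨W, hW⟩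
  · simp only [hW] at hVe hVadd hVτ
    exact .inl (exists_phase_comp_eq (fun _ => rfl) he τ hτ W hVe hVadd hVτ)
  · simp only [hW] at hVe hVadd hVτ
    exact .inr (exists_phase_comp_eq (fun c => RCLike.norm_conj c) he τ hτ W hVe hVadd hVτ)

/-- Polarization: over `ℂ` an operator is determined by its quadratic form, here for rank-one
operators. -/
theorem inner_smul_eq_of_forall_inner_mul_inner {a b a' b' : K}
    (h : ∀ x, ⟪x, a⟫_ℂ * ⟪b, x⟫_ℂ = ⟪x, a'⟫_ℂ * ⟪b', x⟫_ℂ) (y : K) :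
    ⟪b, y⟫_ℂ • a = ⟪b', y⟫_ℂ • a' := by
  have := (ext_inner_map ((innerₛₗ ℂ b).smulRight a) ((innerₛₗ ℂ b').smulRight a')).1 fun x => by
    have hx := congrArg conj (h x)
    simp only [map_mul, inner_conj_symm] at hx
    simpa [inner_smul_left, mul_comm] using hx
  simpa using LinearMap.congr_fun this y

end Wigner

/-! ### The corner of a Hilbert module and the rows of its elements -/

section Module

variable {d : ℕ} {H : Type*} [NormedAddCommGroup H] [Module ℂ H] [Module (MatAlg d) H]
  [CStarModule (MatAlg d) H]

theorem eq_of_forall_inner_right {f g : H}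
    (h : ∀ x : H, inner (MatAlg d) x f = inner (MatAlg d) x g) : f = g := by
  rw [← sub_eq_zero, ← CStarModule.inner_self (A := MatAlg d), CStarModule.inner_sub_right, h,
    sub_self]

theorem matrix_smul_comm (a : MatAlg d) (z : ℂ) (f : H) : a • z • f = z • a • f :=
  eq_of_forall_inner_right (d := d) fun x => by simp

theorem matrix_smul_assoc (a : MatAlg d) (z : ℂ) (f : H) : (z • a) • f = z • a • f :=
  eq_of_forall_inner_right (d := d) fun x => by simp

variable (H) in
/-- The range of the action of the rank-one projection `E_oo`. -/
def corner (o : Fin d) : Submodule ℂ H where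
  carrier := {f | (Matrix.single o o 1 : MatAlg d) • f = f}
  add_mem' := fun {f g} hf hg => by
    rw [Set.mem_ofPred_eq] at *
    rw [smul_add, hf, hg]
  zero_mem' := smul_zero _
  smul_mem' := fun c f hf => by
    rw [Set.mem_ofPred_eq] at *
    rw [matrix_smul_comm, hf]

theorem mem_corner {o : Fin d} {f : H} :
    f ∈ corner H o ↔ (Matrix.single o o 1 : MatAlg d) • f = f := Iff.rfl

theorem inner_corner {o : Fin d} (x y : corner H o) :
    inner (MatAlg d) (x : H) y =
      Matrix.single o o (inner (MatAlg d) (x : H) y o o) := by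
  conv_lhs => rw [← mem_corner.1 x.2, ← mem_corner.1 y.2]
  rw [CStarModule.inner_op_smul_right, CStarModule.inner_op_smul_left, Matrix.star_eq_conjTranspose,
    Matrix.conjTranspose_single, star_one, ← mul_assoc, Matrix.single_mul_mul_single]
  simp

theorem l2_opNorm_single (o : Fin d) (c : ℂ) : ‖(Matrix.single o o c : MatAlg d)‖ = ‖c‖ := by
  rw [← Matrix.diagonal_single, Matrix.l2_opNorm_diagonal, Pi.norm_single]

noncomputable instance cornerNormedSpace (o : Fin d) : NormedSpace ℂ (corner H o) where
  norm_smul_le c x := by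
    rw [Submodule.coe_norm, Submodule.coe_norm, Submodule.coe_smul]
    exact ((CStarModule.normedSpaceCore (MatAlg d)).norm_smul c (x : H)).le

noncomputable instance cornerInnerProductSpace (o : Fin d) :
    InnerProductSpace ℂ (corner H o) where
  inner x y := inner (MatAlg d) (x : H) y o o
  norm_sq_eq_re_inner x := by
    have h0 : 0 ≤ inner (MatAlg d) (x : H) x := CStarModule.inner_self_nonneg
    have h1 : 0 ≤ inner (MatAlg d) (x : H) x o o :=
      (Matrix.nonneg_iff_posSemidef.1 h0).diag_nonneg
    rw [Submodule.coe_norm, CStarModule.norm_sq_eq (MatAlg d), inner_corner, l2_opNorm_single]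
    simpa using congrArg Complex.re (RCLike.norm_of_nonneg' h1)
  conj_inner_symm x y := by
    rw [← CStarModule.star_inner (A := MatAlg d) (y : H) x]
    simp
  add_left x y z := by simp
  smul_left x y c := by simp

theorem corner_inner {o : Fin d} (x y : corner H o) :
    ⟪x, y⟫_ℂ = inner (MatAlg d) (x : H) y o o := rfl

/-- The rows of an element of a Hilbert module over the matrices. -/
def row (o i : Fin d) (f : H) : corner H o :=
  ⟨(Matrix.single o i 1 : MatAlg d) • f, by rw [mem_corner, smul_smul]; simp⟩

theorem row_coe (o i : Fin d) (f : H) :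
    (row o i f : H) = (Matrix.single o i 1 : MatAlg d) • f := rfl

theorem row_add (o i : Fin d) (f g : H) : row o i (f + g) = row o i f + row o i g :=
  Subtype.ext (smul_add _ _ _)

theorem row_smul (o i : Fin d) (c : ℂ) (f : H) : row o i (c • f) = c • row o i f :=
  Subtype.ext (matrix_smul_comm _ _ _)

theorem row_matrix_smul (o i : Fin d) (a : MatAlg d) (f : H) :
    row o i (a • f) = ∑ j, a i j • row o j f := by
  refine Subtype.ext ?_
  rw [AddSubmonoidClass.coe_finsetSum]
  simp only [row_coe, Submodule.coe_smul, smul_smul, ← matrix_smul_assoc, ← Finset.sum_smul]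
  congr 1
  ext k l
  simp only [Matrix.sum_apply, Matrix.smul_apply, Matrix.single_apply, Matrix.mul_apply]
  by_cases hk : o = k <;> simp [hk]

theorem row_corner (o i : Fin d) (x : corner H o) : row o i (x : H) = if i = o then x else 0 := by
  refine Subtype.ext ?_
  rw [row_coe, ← mem_corner.1 x.2, smul_smul]
  split_ifs with h
  · subst h
    simp [mem_corner.1 x.2]
  · simp [h]

theorem sum_single_smul_row (o : Fin d) (f : H) :
    ∑ i, (Matrix.single i o 1 : MatAlg d) • (row o i f : H) = f := by
  simp only [row_coe, smul_smul, ← Finset.sum_smul, Matrix.single_mul_single_same, mul_one]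
  rw [Matrix.sum_single_one, one_smul]

theorem row_ext {o : Fin d} {f g : H} (h : ∀ i, row o i f = row o i g) : f = g := by
  rw [← sum_single_smul_row o f, ← sum_single_smul_row o g]
  simp only [h]

theorem genInner_apply (o : Fin d) (f g : H) (i j : Fin d) :
    genInner d f g i j = ⟪row o j g, row o i f⟫_ℂ := by
  rw [corner_inner, row_coe, row_coe, CStarModule.inner_op_smul_right,
    CStarModule.inner_op_smul_left, Matrix.star_eq_conjTranspose, Matrix.conjTranspose_single,
    star_one, ← mul_assoc, Matrix.single_mul_mul_single]
  simp [genInner]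

/-- Makes corner membership visible in the diagonal of `[f, f]`, whose entries are the squared norms
of the rows. -/
theorem mem_corner_iff_row {o : Fin d} {f : H} : f ∈ corner H o ↔ ∀ i, i ≠ o → row o i f = 0 := by
  refine ⟨fun h i hi => by simpa [hi] using row_corner o i ⟨f, h⟩, fun h => ?_⟩
  rw [← sum_single_smul_row o f, Finset.sum_eq_single o (fun i _ hi => by simp [h i hi]) (by simp)]
  rw [mem_corner.1 (row o o f).2]
  exact (row o o f).2

/-- The element with prescribed rows. -/
def ofRows (o : Fin d) (v : Fin d → corner H o) : H :=
  ∑ i, (Matrix.single i o 1 : MatAlg d) • (v i : H)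

theorem row_ofRows (o : Fin d) (v : Fin d → corner H o) (i : Fin d) :
    row o i (ofRows o v) = v i := by
  refine Subtype.ext ?_
  rw [row_coe, ofRows, Finset.smul_sum, Finset.sum_eq_single i]
  · rw [smul_smul, Matrix.single_mul_single_same, mul_one, mem_corner.1 (v i).2]
  · intro j _ hj
    rw [smul_smul, Matrix.single_mul_single_of_ne _ _ _ _ hj.symm, zero_smul]
  · simp

/-- The linear equivalence of a Hilbert module acting on the rows by a linear isometry. -/
def rowwise (o : Fin d) (V : corner H o ≃ₗᵢ[ℂ] corner H o) : H ≃ₗ[ℂ] H where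
  toFun f := ofRows o fun i => V (row o i f)
  invFun f := ofRows o fun i => V.symm (row o i f)
  map_add' f g := row_ext (o := o) fun i => by simp [row_ofRows, row_add]
  map_smul' c f := row_ext (o := o) fun i => by simp [row_ofRows, row_smul]
  left_inv f := row_ext (o := o) fun i => by simp [row_ofRows]
  right_inv f := row_ext (o := o) fun i => by simp [row_ofRows]

theorem row_rowwise (o : Fin d) (V : corner H o ≃ₗᵢ[ℂ] corner H o) (f : H) (i : Fin d) :
    row o i (rowwise o V f) = V (row o i f) := row_ofRows o _ i

theorem isModuleUnitary_rowwise (o : Fin d) (V : corner H o ≃ₗᵢ[ℂ] corner H o) :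
    IsModuleUnitary d (rowwise o V) where
  map_smul a f := row_ext (o := o) fun i => by
    simp [row_rowwise, row_matrix_smul]
  map_inner f g := by
    ext i j
    simp [genInner_apply o, row_rowwise]

/-! ### Consequences of preserving moduli -/

theorem star_genInner_mul_genInner {f g f' g' : H}
    (h : CFC.abs (genInner d f' g') = CFC.abs (genInner d f g)) :
    star (genInner d f' g') * genInner d f' g' = star (genInner d f g) * genInner d f g := by
  rw [← CFC.abs_mul_abs, h, CFC.abs_mul_abs]

theorem genInner_self_eq {f f' : H}
    (h : CFC.abs (genInner d f' f') = CFC.abs (genInner d f f)) :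
    genInner d f' f' = genInner d f f := by
  rwa [CFC.abs_of_nonneg _ CStarModule.inner_self_nonneg,
    CFC.abs_of_nonneg _ CStarModule.inner_self_nonneg] at h

/-- Only row `o` of `x` is nonzero, so a single term of the matrix product survives. -/
theorem star_genInner_mul_genInner_corner (o : Fin d) (x : corner H o) (f : H) (i j : Fin d) :
    (star (genInner d (x : H) f) * genInner d (x : H) f) i j =
      ⟪x, row o i f⟫_ℂ * ⟪row o j f, x⟫_ℂ := by
  rw [Matrix.mul_apply, Finset.sum_eq_single o]
  · simp [genInner_apply o, row_corner]
  · intro k _ hk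
    simp [genInner_apply o, row_corner, hk]
  · simp

theorem mem_corner_iff_of_genInner_self_eq {o : Fin d} {f f' : H}
    (h : genInner d f' f' = genInner d f f) : f' ∈ corner H o ↔ f ∈ corner H o := by
  rw [mem_corner_iff_row, mem_corner_iff_row]
  have : ∀ i, row o i f' = 0 ↔ row o i f = 0 := fun i => by
    rw [← inner_self_eq_zero (𝕜 := ℂ), ← genInner_apply, h, genInner_apply o, inner_self_eq_zero]
  simp only [this]

/-- The rank-one forms built from the rows determine an element up to a phase. -/
theorem exists_phase_smul_of_rows {o : Fin d} {f g : H} (hfg : genInner d g g = genInner d f f)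
    (h : ∀ x, ∀ i j, ⟪x, row o i g⟫_ℂ * ⟪row o j g, x⟫_ℂ = ⟪x, row o i f⟫_ℂ * ⟪row o j f, x⟫_ℂ) :
    ∃ c : ℂ, ‖c‖ = 1 ∧ g = c • f := by
  by_cases h0 : ∀ i, row o i g = 0
  · refine ⟨1, norm_one, row_ext (o := o) fun i => ?_⟩
    rw [one_smul, h0, eq_comm, ← inner_self_eq_zero (𝕜 := ℂ), ← genInner_apply, ← hfg,
      genInner_apply o, h0, inner_zero_left]
  push Not at h0
  obtain ⟨k, hk⟩ := h0
  have hkk : ⟪row o k g, row o k g⟫_ℂ ≠ 0 := inner_self_ne_zero.2 hk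
  -- A single nonzero row `k` of `g` fixes the scalar for all rows at once.
  set c := ⟪row o k f, row o k g⟫_ℂ / ⟪row o k g, row o k g⟫_ℂ with hc
  have hg : ∀ i, row o i g = c • row o i f := fun i => by
    have := inner_smul_eq_of_forall_inner_mul_inner (fun x => h x i k) (row o k g)
    rw [hc, div_eq_inv_mul, mul_smul, ← this, inv_smul_smul₀ hkk]
  refine ⟨c, ?_, row_ext (o := o) fun i => by rw [hg, row_smul]⟩
  have hn : ‖row o k g‖ = ‖row o k f‖ := by
    rw [← sq_eq_sq₀ (norm_nonneg _) (norm_nonneg _), norm_sq_eq_re_inner (𝕜 := ℂ),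
      norm_sq_eq_re_inner (𝕜 := ℂ), ← genInner_apply, ← genInner_apply, hfg]
  have hk' : ‖row o k f‖ ≠ 0 := hn ▸ norm_ne_zero_iff.2 hk
  rw [hg, norm_smul] at hn
  exact mul_right_cancel₀ hk' (by rw [hn, one_mul])

/-- The action of a map preserving generalized inner products up to moduli on the corner. -/
theorem exists_corner_map {T : H → H} (hT : Function.Surjective T)
    (hTabs : ∀ f f' : H, CFC.abs (genInner d (T f) (T f')) = CFC.abs (genInner d f f'))
    (o : Fin d) : ∃ τ : corner H o → corner H o, Function.Surjective τ ∧
      (∀ x : corner H o, T x = τ x) ∧ ∀ x y, ‖⟪τ x, τ y⟫_ℂ‖ = ‖⟪x, y⟫_ℂ‖ := by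
  have hmem : ∀ f, T f ∈ corner H o ↔ f ∈ corner H o := fun f =>
    mem_corner_iff_of_genInner_self_eq (genInner_self_eq (hTabs f f))
  refine ⟨fun x => ⟨T x, (hmem x).2 x.2⟩, fun y => ?_, fun x => rfl, fun x y => ?_⟩
  · obtain ⟨f, hf⟩ := hT y
    exact ⟨⟨f, (hmem f).1 (hf ▸ y.2)⟩, Subtype.ext hf⟩
  · have h := star_genInner_mul_genInner (hTabs x y)
    have h1 := star_genInner_mul_genInner_corner o x (y : H) o o
    have h2 := star_genInner_mul_genInner_corner o ⟨T x, (hmem x).2 x.2⟩ (T y) o o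
    have h3 := row_corner o o ⟨T y, (hmem y).2 y.2⟩
    rw [h] at h2
    rw [h2, row_corner] at h1
    simp only at h3
    rw [h3] at h1
    simp only [if_true] at h1
    have := congrArg norm h1
    rw [norm_mul, norm_mul, norm_inner_symm y x, norm_inner_symm _ (⟨T x, _⟩ : corner H o),
      ← sq, ← sq, sq_eq_sq₀ (norm_nonneg _) (norm_nonneg _)] at this
    exact this

theorem inner_row_mul_inner_row {T : H → H}
    (hTabs : ∀ f f' : H, CFC.abs (genInner d (T f) (T f')) = CFC.abs (genInner d f f'))
    {o : Fin d} {x y : corner H o} {c : ℂ} (hc : ‖c‖ = 1) (hx : T x = ((c • y : corner H o) : H))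
    (f : H) (i j : Fin d) :
    ⟪y, row o i (T f)⟫_ℂ * ⟪row o j (T f), y⟫_ℂ = ⟪x, row o i f⟫_ℂ * ⟪row o j f, x⟫_ℂ := by
  have h := star_genInner_mul_genInner (hTabs x f)
  rw [hx] at h
  rw [← star_genInner_mul_genInner_corner o x, ← h, star_genInner_mul_genInner_corner,
    inner_smul_left, inner_smul_right, mul_mul_mul_comm, mul_comm (conj c), Complex.mul_conj,
    Complex.normSq_eq_norm_sq, hc]
  simp

/-! ### The linear and the conjugate-linear case -/

theorem exists_moduleUnitary {T : H → H}
    (hTabs : ∀ f f' : H, CFC.abs (genInner d (T f) (T f')) = CFC.abs (genInner d f f'))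
    {o : Fin d} {τ : corner H o → corner H o} (hτ : Function.Surjective τ)
    (hTτ : ∀ x : corner H o, T x = τ x) (V : corner H o →ₗᵢ[ℂ] corner H o)
    (hV : ∀ x, ∃ c : ℂ, ‖c‖ = 1 ∧ τ x = c • V x) :
    ∃ (U : H ≃ₗ[ℂ] H) (φ : H → ℂ), IsModuleUnitary d U ∧ IsPhaseFunction φ ∧
      ∀ f : H, T f = φ f • U f := by
  have hsurj : Function.Surjective V := fun y => by
    obtain ⟨x, hx⟩ := hτ y
    obtain ⟨c, -, hc⟩ := hV x
    exact ⟨c • x, by rw [map_smul, ← hc, hx]⟩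
  have hU := isModuleUnitary_rowwise o (LinearIsometryEquiv.ofSurjective V hsurj)
  have key : ∀ f, ∃ c : ℂ, ‖c‖ = 1 ∧
      T f = c • rowwise o (LinearIsometryEquiv.ofSurjective V hsurj) f := by
    intro f
    refine exists_phase_smul_of_rows (o := o)
      ((genInner_self_eq (hTabs f f)).trans (hU.map_inner f f).symm) fun y i j => ?_
    obtain ⟨x, rfl⟩ := hsurj y
    obtain ⟨c, hc, hcx⟩ := hV x
    rw [inner_row_mul_inner_row hTabs hc (by rw [hTτ, hcx])]
    simp [row_rowwise]
  choose φ hφ hTφ using key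
  exact ⟨_, φ, hU, hφ, hTφ⟩

theorem false_of_conj_linear (hd : 1 < d) (hgh : ∃ g h : H, genInner d g h = 1) {T : H → H}
    (hTabs : ∀ f f' : H, CFC.abs (genInner d (T f) (T f')) = CFC.abs (genInner d f f'))
    {o : Fin d} {τ : corner H o → corner H o} (hτ : Function.Surjective τ)
    (hTτ : ∀ x : corner H o, T x = τ x) (V : corner H o →ₛₗᵢ[starRingEnd ℂ] corner H o)
    (hV : ∀ x, ∃ c : ℂ, ‖c‖ = 1 ∧ τ x = c • V x) : False := by
  obtain ⟨f, h, hfh⟩ := hgh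
  have hsurj : Function.Surjective V := fun y => by
    obtain ⟨x, hx⟩ := hτ y
    obtain ⟨c, -, hc⟩ := hV x
    exact ⟨conj c • x, by rw [map_smulₛₗ, Complex.conj_conj, ← hc, hx]⟩
  choose g hg using fun i => hsurj (row o i (T f))
  -- Conjugate-linearity of `V` swaps the two factors, so `i` and `j` trade places between the two
  -- sides.
  have hpol : ∀ i j y, ⟪g i, y⟫_ℂ • g j = ⟪row o j f, y⟫_ℂ • row o i f := by
    intro i j
    refine inner_smul_eq_of_forall_inner_mul_inner fun x => ?_
    obtain ⟨c, hc, hcx⟩ := hV x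
    rw [← inner_row_mul_inner_row hTabs hc (by rw [hTτ, hcx]) f i j, ← hg, ← hg,
      inner_map_map_of_conj_isometry, inner_map_map_of_conj_isometry, mul_comm]
  have hδ : ∀ i j, ⟪row o j h, row o i f⟫_ℂ = if i = j then 1 else 0 := fun i j => by
    rw [← genInner_apply, hfh, Matrix.one_apply]
  have hf0 : ∀ i, row o i f ≠ 0 := fun i hi => by
    have := hδ i i
    simp [hi] at this
  have hg0 : ∀ i, g i ≠ 0 := fun i hi => by
    have := hpol i i (row o i f)
    rw [hi, smul_zero, eq_comm, smul_eq_zero, or_iff_left (hf0 i)] at this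
    exact hf0 i (inner_self_eq_zero.1 this)
  have hne : (⟨0, by omega⟩ : Fin d) ≠ ⟨1, hd⟩ := by simp
  generalize (⟨0, by omega⟩ : Fin d) = i, (⟨1, hd⟩ : Fin d) = j at hne
  -- By `hpol`, `g j` is a multiple of `row o j f`, hence orthogonal to `row o i h`. Testing `hpol i
  -- j` against `row o i h` then gives `⟪row o j f, g i⟫ = 0`, so one of `g i`, `g j` vanishes.
  have h1 := congrArg (fun v => ⟪row o i h, v⟫_ℂ) (hpol i j (g i))
  have h2 := congrArg (fun v => ⟪row o i h, v⟫_ℂ) (hpol j j (g j))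
  simp only [inner_smul_right, hδ, if_true, hne.symm, if_false, mul_one, mul_zero] at h1 h2
  have h3 : ⟪row o i h, g j⟫_ℂ = 0 :=
    (mul_eq_zero.1 h2).resolve_left (inner_self_ne_zero.2 (hg0 j))
  rw [h3, mul_zero] at h1
  have h4 := hpol i j (g i)
  rw [← h1, zero_smul, smul_eq_zero] at h4
  rcases h4 with h4 | h4
  · exact hg0 i (inner_self_eq_zero.1 h4)
  · exact hg0 j h4

theorem mem_corner_of_eq_one (hd : d = 1) (o : Fin d) (f : H) : f ∈ corner H o := by
  subst hd
  exact mem_corner_iff_row.2 fun i hi => absurd (Subsingleton.elim i o) hi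

theorem exists_antiunitary (hd : d = 1) {T : H → H} {o : Fin d} {τ : corner H o → corner H o}
    (hτ : Function.Surjective τ) (hTτ : ∀ x : corner H o, T x = τ x)
    (V : corner H o →ₛₗᵢ[starRingEnd ℂ] corner H o)
    (hV : ∀ x, ∃ c : ℂ, ‖c‖ = 1 ∧ τ x = c • V x) :
    ∃ (U : H ≃ₛₗ[starRingEnd ℂ] H) (φ : H → ℂ), IsAntiunitaryOp d U ∧ IsPhaseFunction φ ∧
      ∀ f : H, T f = φ f • U f := by
  have hsurj : Function.Surjective V := fun y => by
    obtain ⟨x, hx⟩ := hτ y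
    obtain ⟨c, -, hc⟩ := hV x
    exact ⟨conj c • x, by rw [map_smulₛₗ, Complex.conj_conj, ← hc, hx]⟩
  have htop : corner H o = ⊤ := eq_top_iff.2 fun f _ => mem_corner_of_eq_one hd o f
  let E : corner H o ≃ₗ[ℂ] H := LinearEquiv.ofTop _ htop
  let W : corner H o ≃ₛₗ[starRingEnd ℂ] corner H o :=
    LinearEquiv.ofBijective V.toLinearMap ⟨V.injective, hsurj⟩
  choose φ hφ hτφ using hV
  refine ⟨(E.symm.trans W).trans E, φ ∘ E.symm, fun f f' => ?_, fun f => hφ _, fun f => ?_⟩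
  · ext i j
    have hi : ∀ i : Fin d, i = o := by subst hd; exact fun i => Subsingleton.elim i o
    rw [genInner_apply o, genInner_apply o, hi i, hi j]
    have h1 : ∀ x : corner H o, row o o (x : H) = x := fun x => by rw [row_corner, if_pos rfl]
    have h2 : ∀ f : H, row o o f = E.symm f := fun f => h1 (E.symm f)
    change ⟪row o o (V (E.symm f') : H), row o o (V (E.symm f) : H)⟫_ℂ = _
    rw [h1, h1, inner_map_map_of_conj_isometry, h2, h2]
  · exact (hTτ (E.symm f)).trans (congrArg Subtype.val (hτφ (E.symm f)))

end Module

theorem theorem1 (d : ℕ) {H : Type*} [NormedAddCommGroup H] [Module ℂ H] [Module (MatAlg d) H]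
    [CStarModule (MatAlg d) H] [CompleteSpace H]
    (hgh : ∃ g h : H, genInner d g h = 1)
    (T : H → H) (hT : Function.Surjective T)
    (hTabs : ∀ f f' : H, CFC.abs (genInner d (T f) (T f')) = CFC.abs (genInner d f f')) :
    (1 < d → ∃ (U : H ≃ₗ[ℂ] H) (φ : H → ℂ), IsModuleUnitary d U ∧ IsPhaseFunction φ ∧
      ∀ f : H, T f = φ f • U f) ∧
    (d = 1 →
      (∃ (U : H ≃ₗ[ℂ] H) (φ : H → ℂ), IsUnitaryOp d U ∧ IsPhaseFunction φ ∧
        ∀ f : H, T f = φ f • U f) ∨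
      (∃ (U : H ≃ₛₗ[starRingEnd ℂ] H) (φ : H → ℂ), IsAntiunitaryOp d U ∧ IsPhaseFunction φ ∧
        ∀ f : H, T f = φ f • U f)) := by
  refine ⟨fun hd => ?_, fun hd => ?_⟩
  · obtain ⟨τ, hτs, hTτ, hτ⟩ := exists_corner_map hT hTabs ⟨0, by omega⟩
    rcases wigner τ hτ with ⟨V, hV⟩ | ⟨V, hV⟩
    · exact exists_moduleUnitary hTabs hτs hTτ V hV
    · exact (false_of_conj_linear hd hgh hTabs hτs hTτ V hV).elim
  · obtain ⟨τ, hτs, hTτ, hτ⟩ := exists_corner_map hT hTabs ⟨0, by omega⟩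
    rcases wigner τ hτ with ⟨V, hV⟩ | ⟨V, hV⟩
    · obtain ⟨U, φ, hU, h⟩ := exists_moduleUnitary hTabs hτs hTτ V hV
      exact .inl ⟨U, φ, hU.map_inner, h⟩
    · exact .inr (exists_antiunitary hd hτs hTτ V hV)
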